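/- Let $\alpha\in(2,4)$ and let $X_{11},X_{12},\ldots$ be i.i.d. real random variables with $\mathbb E[X_{11}^2]=1$ and $\mathbb P(|X_{11}|>x)=x^{-\alpha}L(x)$ for all $x>0$, where $L$ is slowly varying at infinity (that is, $L$ is measurable and positive on some half-line $(a,\infty)$, and $L(cx)/L(x)\to1$ as $x\to\infty$ for every $c>0$). For $n\ge1$ and $1\le j\le n$ put $$Y_{1j}=Y_{1j}^{(n)}=\frac{X_{1j}}{\sqrt{X_{11}^2+\cdots+X_{1n}^2}},$$ with the convention $Y_{1j}=0$ when the denominator vanishes. For $r\ge1$, integers $k_1,\ldots,k_r\ge1$ and $n\ge r$ let $$\beta_{2k_1,\ldots,2k_r}=\mathbb E\big[Y_{11}^{2k_1}\cdots Y_{1r}^{2k_r}\big],\qquad N_1=\#\{1\le i\le r:\ k_i=1\}.$$ Then $$\lim_{n\to\infty}\frac{n^{N_1(1-\alpha/2)+r\alpha/2}}{L(n^{1/2})^{\,r-N_1}}\,\beta_{2k_1,\ldots,2k_r}=\frac{(\alpha/2)^{r-N_1}\,\Gamma\big(N_1(1-\alpha/2)+r\alpha/2\big)\prod_{i:\,k_i\ge2}\Gamma(k_i-\alpha/2)}{\Gamma(k_1+\cdots+k_r)}.$$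 In particular, for every integer $k\ge2$, $$\lim_{n\to\infty}\frac{n^{\alpha/2}}{L(n^{1/2})}\,\beta_{2k}=\frac{\alpha\,\Gamma(\alpha/2)\,\Gamma(k-\alpha/2)}{2\,\Gamma(k)}.$$ -/

import Mathlib

open MeasureTheory ProbabilityTheory Filter Topology

/-- `L` is slowly varying at infinity: it is measurable and positive on some half-line `(a, ∞)`,
and `L (c x) / L x → 1` as `x → ∞` for every fixed `c > 0`. -/
structure IsSlowlyVarying (L : ℝ → ℝ) : Prop where
  measurable_pos : ∃ a : ℝ, Measurable (fun x : Set.Ioi a => L x) ∧ ∀ x, a < x → 0 < L x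
  tendsto_ratio : ∀ c : ℝ, 0 < c → Tendsto (fun x => L (c * x) / L x) atTop (𝓝 1)

/-- The self-normalized variable `X_j / √(X_0 ^ 2 + ⋯ + X_{n-1} ^ 2)`, where `X_0, X_1, …` is a row
of the data matrix (indexed from `0`). It is `0` on the event that the denominator vanishes. -/
noncomputable def selfNormalized {Ω : Type*} (X : ℕ → Ω → ℝ) (n j : ℕ) (ω : Ω) : ℝ :=
  X j ω / Real.sqrt (∑ l ∈ Finset.range n, X l ω ^ 2)

/-- The mixed moment `β_{2k_1, …, 2k_r} = E[Y_1 ^ (2 k_1) ⋯ Y_r ^ (2 k_r)]` for sample size `n`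
(which is meaningful for `r ≤ n`). -/
noncomputable def mixedMoment {Ω : Type*} [MeasurableSpace Ω] (P : Measure Ω) (X : ℕ → Ω → ℝ)
    (n : ℕ) {r : ℕ} (k : Fin r → ℕ) : ℝ :=
  ∫ ω, ∏ i : Fin r, selfNormalized X n i ω ^ (2 * k i) ∂P

/-- The number `N_1` of indices `i` with `k_i = 1`. -/
def numOnes {r : ℕ} (k : Fin r → ℕ) : ℕ :=
  (Finset.univ.filter fun i => k i = 1).card

/-! Put `Z_j = X_j ^ 2`, `a = α / 2 ∈ (1, 2)`, `G y = P(Z > y) = y ^ (-a) * L (√y)`, `K = ∑ k_i` and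
`M_k t = E[(t Z) ^ k e ^ (-t Z)]`. Since `Γ(K) / S ^ K = ∫ t ^ (K - 1) e ^ (-S t) dt` over `t > 0`,
the random denominator becomes an exponential, and independence gives `Γ(K) β = ∫ t⁻¹ ∏ M_{k_i}(t)
M_0(t) ^ (n - r) dt` (`Gamma_mul_mixedMoment`).

The integral lives at the scale `t = s / n`. There `M_0 ^ (n - r) → e ^ (-s)` and `n M_1 → s`,
because the mean is one; for `k ≥ 2` the heavy tail dominates and `M_k / G n → a Γ(k - a) s ^ a`
(`tendsto_laplaceMoment`). The limiting integrand is a constant times `s ^ (p - 1) e ^ (-s)` with `p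
= N_1 + (r - N_1) a`, whence the factor `Γ(p)`.

Limit and integral are exchanged by dominated convergence: Potter bounds control `M_k` for `k ≥ 2`,
and `M_0 t ≤ e ^ (-t / 2)` near zero (`tendsto_main_part`). Away from zero, `M_0` stays below a
constant less than one, whose powers beat the polynomial normalization (`tendsto_tail_part`). -/

/-! ### Potter bounds for regularly varying tails -/

/-- Potter-type bound for a monotone regularly varying tail of index in `(-2, -1)`. -/
theorem potter_bound {G : ℝ → ℝ} (hanti : Antitone G) (hpos : ∀ y, 0 < G y) (hle : ∀ y, G y ≤ 1)
    {a : ℝ} (ha1 : 1 < a) (ha2 : a < 2)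
    (hrv : ∀ c : ℝ, 0 < c → Tendsto (fun y => G (c * y) / G y) atTop (𝓝 (c ^ (-a)))) :
    ∃ b C y₀ : ℝ, 1 < b ∧ b < 2 ∧ 0 < C ∧ 0 < y₀ ∧
      ∀ y, y₀ ≤ y → ∀ l, 0 < l → G (l * y) ≤ C * (l⁻¹ + l ^ (-b)) * G y := by
  obtain ⟨b, hab, hb2⟩ := exists_between ha2
  have h2 := hrv 2 two_pos
  -- Doubling the argument multiplies `G` by about `2 ^ (-a)`, which lies strictly between `2 ^
  -- (-b)` and `2⁻¹` because `1 < a < b`.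
  have hup : ∀ᶠ y in atTop, G (2 * y) / G y < (2 : ℝ) ^ (-1 : ℝ) :=
    h2.eventually_lt_const (Real.rpow_lt_rpow_of_exponent_lt one_lt_two (by linarith))
  have hlo : ∀ᶠ y in atTop, (2 : ℝ) ^ (-b) < G (2 * y) / G y :=
    h2.eventually_const_lt (Real.rpow_lt_rpow_of_exponent_lt one_lt_two (by linarith))
  obtain ⟨y₁, hy₁⟩ := eventually_atTop.1 (hup.and hlo)
  set y₀ := max y₁ 1 with hy₀
  have hy₀1 : 1 ≤ y₀ := le_max_right _ _
  have step : ∀ y, y₀ ≤ y → G (2 * y) ≤ 2⁻¹ * G y ∧ G y ≤ 2 ^ b * G (2 * y) := by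
    intro y hy
    obtain ⟨h3, h4⟩ := hy₁ y (le_trans (le_max_left _ _) hy)
    rw [div_lt_iff₀ (hpos y), Real.rpow_neg_one] at h3
    rw [lt_div_iff₀ (hpos y), Real.rpow_neg two_pos.le, inv_mul_lt_iff₀ (by positivity)] at h4
    exact ⟨h3.le, h4.le⟩
  have iter : ∀ m : ℕ, ∀ y, y₀ ≤ y →
      G (2 ^ m * y) ≤ (2 ^ m)⁻¹ * G y ∧ G y ≤ (2 ^ b) ^ m * G (2 ^ m * y) := by
    intro m
    induction m with
    | zero => intro y _; simp
    | succ m ih =>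
      intro y hy
      have hm : (1 : ℝ) ≤ 2 ^ m := one_le_pow₀ one_le_two
      have hy' : y₀ ≤ 2 ^ m * y := by nlinarith
      obtain ⟨h3, h4⟩ := ih y hy
      obtain ⟨h5, h6⟩ := step _ hy'
      have e : (2 : ℝ) ^ (m + 1) * y = 2 * (2 ^ m * y) := by ring
      rw [e]
      constructor
      · calc _ ≤ 2⁻¹ * G (2 ^ m * y) := h5
          _ ≤ 2⁻¹ * ((2 ^ m)⁻¹ * G y) := by gcongr
          _ = _ := by rw [pow_succ, mul_inv]; ring
      · calc _ ≤ (2 ^ b) ^ m * G (2 ^ m * y) := h4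
          _ ≤ (2 ^ b) ^ m * (2 ^ b * G (2 * (2 ^ m * y))) := by gcongr
          _ = _ := by rw [pow_succ]; ring
  have hb4 : (2 : ℝ) ^ b ≤ 4 := by
    calc (2 : ℝ) ^ b ≤ 2 ^ (2 : ℝ) := Real.rpow_le_rpow_of_exponent_le one_le_two hb2.le
      _ = 4 := by norm_num
  have up : ∀ y, y₀ ≤ y → ∀ l, 1 ≤ l → G (l * y) ≤ 2 * l⁻¹ * G y := by
    intro y hy l hl
    obtain ⟨m, hm1, hm2⟩ := exists_nat_pow_near hl one_lt_two
    calc G (l * y) ≤ G (2 ^ m * y) := hanti (by gcongr; linarith)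
      _ ≤ (2 ^ m)⁻¹ * G y := (iter m y hy).1
      _ ≤ 2 * l⁻¹ * G y := by
        have := (hpos y).le
        gcongr
        rw [← div_eq_mul_inv, le_div_iff₀ (by linarith), inv_mul_le_iff₀ (by positivity)]
        rw [pow_succ] at hm2
        linarith
  -- Here `2 ^ m ≤ l⁻¹ < 2 ^ (m + 1)`; the surplus doubling costs `2 ^ b ≤ 4`.
  have down : ∀ y, ∀ l, 0 < l → l ≤ 1 → y₀ ≤ l * y → G (l * y) ≤ 4 * l ^ (-b) * G y := by
    intro y l hl hl1 hy
    obtain ⟨m, hm1, hm2⟩ := exists_nat_pow_near ((one_le_inv₀ hl).2 hl1) one_lt_two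
    have hy0 : 0 < y := by
      by_contra! h
      nlinarith
    calc G (l * y) ≤ (2 ^ b) ^ (m + 1) * G (2 ^ (m + 1) * (l * y)) := (iter (m + 1) _ hy).2
      _ ≤ (2 ^ b) ^ (m + 1) * G y := by
        gcongr
        apply hanti
        rw [← mul_assoc]
        rw [inv_lt_iff_one_lt_mul₀ hl] at hm2
        nlinarith
      _ ≤ 4 * l ^ (-b) * G y := by
        have := (hpos y).le
        gcongr
        rw [pow_succ, mul_comm, Real.rpow_neg hl.le, ← Real.inv_rpow hl.le,
          ← Real.rpow_mul_natCast two_pos.le,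
          mul_comm b, Real.rpow_mul two_pos.le, Real.rpow_natCast]
        have hb0 : 0 ≤ b := by linarith
        gcongr
  have hG0 := hpos y₀
  have hG1 : 1 ≤ (G y₀)⁻¹ := (one_le_inv₀ hG0).2 (hle _)
  refine ⟨b, 4 * (G y₀)⁻¹, y₀, by linarith, hb2, by positivity, by linarith, ?_⟩
  intro y hy l hl
  have hGy := (hpos y).le
  have hl' : 0 < l⁻¹ := inv_pos.2 hl
  have hlb : 0 < l ^ (-b) := Real.rpow_pos_of_pos hl _
  rcases le_total 1 l with h | h
  · refine (up y hy l h).trans ?_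
    gcongr ?_ * _
    nlinarith [mul_pos hl' (inv_pos.2 hG0), mul_pos hlb (inv_pos.2 hG0)]
  rcases le_total y₀ (l * y) with h' | h'
  · refine (down y l hl h h').trans ?_
    gcongr ?_ * _
    nlinarith [mul_pos hl' (inv_pos.2 hG0), mul_pos hlb (inv_pos.2 hG0)]
  -- Below `y₀` only `G ≤ 1` is available. The factor `(G y₀)⁻¹` turns it into a comparison with `G
  -- y₀`, to which `down` applies with ratio `y₀ / y ≥ l`.
  · have hy0 : 0 < y := by linarith
    have h5 := down y (y₀ / y) (by positivity) ((div_le_one hy0).2 hy) (by field_simp; rfl)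
    rw [div_mul_cancel₀ _ hy0.ne'] at h5
    have h6 : (y₀ / y) ^ (-b) ≤ l ^ (-b) :=
      Real.rpow_le_rpow_of_nonpos hl ((le_div_iff₀ hy0).2 h') (by linarith)
    calc G (l * y) ≤ 1 := hle _
      _ = (G y₀)⁻¹ * G y₀ := by field_simp
      _ ≤ (G y₀)⁻¹ * (4 * (y₀ / y) ^ (-b) * G y) := by gcongr
      _ ≤ (G y₀)⁻¹ * (4 * (l⁻¹ + l ^ (-b)) * G y) := by gcongr; linarith
      _ = _ := by ring

/-! ### Laplace moments and their Abelian asymptotics -/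

/-- The normalized Laplace moment `E[(t ξ) ^ k e ^ (-t ξ)]` of a law `μ`. -/
noncomputable def laplaceMoment (μ : Measure ℝ) (k : ℕ) (t : ℝ) : ℝ :=
  ∫ x, (t * x) ^ k * Real.exp (-(t * x)) ∂μ

/-- The exponential damping keeps every Laplace moment finite, although the law itself may have no
second moment. -/
theorem pow_mul_exp_neg_le (k : ℕ) {x : ℝ} (hx : 0 ≤ x) :
    x ^ k * Real.exp (-x) ≤ k.factorial := by
  rw [Real.exp_neg, ← div_eq_mul_inv, div_le_iff₀ (Real.exp_pos x)]
  have := Real.pow_div_factorial_le_exp x hx k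
  rw [div_le_iff₀ (by positivity)] at this
  linarith

theorem laplaceMoment_nonneg {μ : Measure ℝ} (hμ : ∀ᵐ x ∂μ, 0 ≤ x) (k : ℕ) {t : ℝ} (ht : 0 ≤ t) :
    0 ≤ laplaceMoment μ k t := by
  apply integral_nonneg_of_ae
  filter_upwards [hμ] with x hx
  have := mul_nonneg ht hx
  simp only [Pi.zero_apply]
  positivity

theorem integrable_laplaceMoment {μ : Measure ℝ} [IsProbabilityMeasure μ] (hμ : ∀ᵐ x ∂μ, 0 ≤ x)
    (k : ℕ) {t : ℝ} (ht : 0 ≤ t) : Integrable (fun x => (t * x) ^ k * Real.exp (-(t * x))) μ := by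
  refine Integrable.of_bound (by fun_prop) (k.factorial : ℝ) ?_
  filter_upwards [hμ] with x hx
  have := mul_nonneg ht hx
  rw [Real.norm_of_nonneg (by positivity)]
  exact pow_mul_exp_neg_le k this

theorem measurable_laplaceMoment (μ : Measure ℝ) [IsProbabilityMeasure μ] (k : ℕ) :
    Measurable (laplaceMoment μ k) := by
  have : StronglyMeasurable
      (Function.uncurry fun t x : ℝ => (t * x) ^ k * Real.exp (-(t * x))) := by
    apply Continuous.stronglyMeasurable
    unfold Function.uncurry
    fun_prop
  exact this.integral_prod_right.measurable

/-- The derivative of `u ^ k e ^ (-u)`. -/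
noncomputable def powExpDeriv (k : ℕ) (u : ℝ) : ℝ :=
  (k * u ^ (k - 1) - u ^ k) * Real.exp (-u)

theorem continuous_powExpDeriv (k : ℕ) : Continuous (powExpDeriv k) := by
  unfold powExpDeriv
  fun_prop

theorem hasDerivAt_pow_mul_exp_neg (k : ℕ) (u : ℝ) :
    HasDerivAt (fun u => u ^ k * Real.exp (-u)) (powExpDeriv k u) u := by
  have h := (hasDerivAt_pow k u).mul ((hasDerivAt_neg u).exp)
  refine h.congr_deriv ?_
  unfold powExpDeriv
  ring

theorem integrableOn_rpow_mul_exp_neg {p : ℝ} (hp : -1 < p) :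
    IntegrableOn (fun u : ℝ => u ^ p * Real.exp (-u)) (Set.Ioi 0) := by
  have := Real.GammaIntegral_convergent (s := p + 1) (by linarith)
  simpa [mul_comm] using this

theorem integral_rpow_mul_exp_neg {p : ℝ} (hp : -1 < p) :
    ∫ u in Set.Ioi (0 : ℝ), u ^ p * Real.exp (-u) = Real.Gamma (p + 1) := by
  rw [Real.Gamma_eq_integral (by linarith)]
  simp [mul_comm]

theorem integrableOn_powExpDeriv (k : ℕ) : IntegrableOn (powExpDeriv k) (Set.Ioi 0) := by
  have h1 := (integrableOn_rpow_mul_exp_neg (p := (k - 1 : ℕ))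
    (by have : (0 : ℝ) ≤ (k - 1 : ℕ) := by positivity
        linarith)).const_mul (k : ℝ)
  have h2 := integrableOn_rpow_mul_exp_neg (p := k) (by have : (0 : ℝ) ≤ k := by positivity
                                                        linarith)
  refine (h1.sub h2).congr ?_
  filter_upwards with u
  simp only [powExpDeriv, Pi.sub_apply, Real.rpow_natCast]
  ring

/-- Fundamental theorem of calculus; the boundary term at `0` vanishes because `k ≥ 1`. -/
theorem integral_indicator_powExpDeriv {k : ℕ} (hk : 1 ≤ k) {T : ℝ} (hT : 0 ≤ T) :
    ∫ u in Set.Ioi (0 : ℝ), (if u < T then powExpDeriv k u else 0) = T ^ k * Real.exp (-T) := by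
  have e : (fun u => if u < T then powExpDeriv k u else 0)
      = (Set.Iio T).indicator (powExpDeriv k) := by
    ext u
    simp [Set.indicator_apply]
  rw [e, setIntegral_indicator measurableSet_Iio, Set.Ioi_inter_Iio,
    ← integral_Ioc_eq_integral_Ioo, ← intervalIntegral.integral_of_le hT,
    intervalIntegral.integral_eq_sub_of_hasDerivAt (fun u _ => hasDerivAt_pow_mul_exp_neg k u)
      ((continuous_powExpDeriv k).intervalIntegrable _ _)]
  simp [show k ≠ 0 by omega]

/-- Layer-cake formula for the normalized Laplace moment. -/
theorem laplaceMoment_eq_integral_tail {μ : Measure ℝ} [IsProbabilityMeasure μ]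
    (hμ : ∀ᵐ x ∂μ, 0 ≤ x) {k : ℕ} (hk : 1 ≤ k) {t : ℝ} (ht : 0 < t) :
    laplaceMoment μ k t
      = ∫ u in Set.Ioi (0 : ℝ), powExpDeriv k u * μ.real (Set.Ioi (u / t)) := by
  have h1 : laplaceMoment μ k t
      = ∫ x, (∫ u in Set.Ioi (0 : ℝ), (if u < t * x then powExpDeriv k u else 0)) ∂μ := by
    apply integral_congr_ae
    filter_upwards [hμ] with x hx
    exact (integral_indicator_powExpDeriv hk (mul_nonneg ht.le hx)).symm
  rw [h1, integral_integral_swap]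
  · apply setIntegral_congr_fun measurableSet_Ioi
    intro u _
    have e : (fun x => if u < t * x then powExpDeriv k u else 0)
        = (Set.Ioi (u / t)).indicator (fun _ => powExpDeriv k u) := by
      ext x
      simp [Set.indicator_apply, div_lt_iff₀' ht]
    simp only [e]
    rw [integral_indicator_const _ measurableSet_Ioi, smul_eq_mul, mul_comm]
  · have hs : MeasurableSet {z : ℝ × ℝ | z.2 < t * z.1} :=
      measurableSet_lt measurable_snd (by fun_prop)
    have hi : Integrable (fun z : ℝ × ℝ => powExpDeriv k z.2)
        (μ.prod (volume.restrict (Set.Ioi 0))) :=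
      Integrable.comp_snd (integrableOn_powExpDeriv k) μ
    refine (hi.indicator hs).congr ?_
    filter_upwards with z
    simp [Set.indicator_apply, Function.uncurry]

/-- The two Gamma integrals combine to `k Γ(k - a) - (k - a) Γ(k - a)`. The first converges at `0`
because `k ≥ 2 > a`, which is why `k = 1` is treated apart. -/
theorem integral_powExpDeriv_mul_rpow {k : ℕ} (hk : 2 ≤ k) {a : ℝ} (ha2 : a < 2) :
    ∫ u in Set.Ioi (0 : ℝ), powExpDeriv k u * u ^ (-a) = a * Real.Gamma (k - a) := by
  have hk' : (2 : ℝ) ≤ k := by exact_mod_cast hk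
  have e : ∀ u ∈ Set.Ioi (0 : ℝ), powExpDeriv k u * u ^ (-a)
      = k * (u ^ (k - 1 - a : ℝ) * Real.exp (-u)) - u ^ (k - a : ℝ) * Real.exp (-u) := by
    intro u (hu : 0 < u)
    have e1 : u ^ (k - 1 - a : ℝ) = u ^ (k - 1) * u ^ (-a) := by
      rw [← Real.rpow_natCast, ← Real.rpow_add hu]
      congr 1
      push_cast [show 1 ≤ k by omega]
      ring
    have e2 : u ^ (k - a : ℝ) = u ^ k * u ^ (-a) := by
      rw [← Real.rpow_natCast, ← Real.rpow_add hu]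
      congr 1
    rw [e1, e2, powExpDeriv]
    ring
  rw [setIntegral_congr_fun measurableSet_Ioi e, integral_sub, integral_const_mul,
    integral_rpow_mul_exp_neg (by linarith), integral_rpow_mul_exp_neg (by linarith),
    Real.Gamma_add_one (by linarith : (k - a : ℝ) ≠ 0)]
  · rw [show (k - 1 - a + 1 : ℝ) = k - a by ring]
    ring
  · exact (integrableOn_rpow_mul_exp_neg (by linarith)).const_mul _
  · exact integrableOn_rpow_mul_exp_neg (by linarith)

theorem integrableOn_abs_powExpDeriv_mul {k : ℕ} (hk : 2 ≤ k) {b : ℝ} (hb2 : b < 2) :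
    IntegrableOn (fun u => |powExpDeriv k u| * u ^ (-b)) (Set.Ioi 0) := by
  have hk' : (2 : ℝ) ≤ k := by exact_mod_cast hk
  have h1 := (integrableOn_rpow_mul_exp_neg (p := k - 1 - b) (by linarith)).const_mul (k : ℝ)
  have h2 := integrableOn_rpow_mul_exp_neg (p := k - b) (by linarith)
  refine (h1.add h2).mono' ?_ ?_
  · have := (continuous_powExpDeriv k).measurable
    apply Measurable.aestronglyMeasurable
    fun_prop
  filter_upwards [ae_restrict_mem measurableSet_Ioi] with u (hu : 0 < u)
  have e1 : u ^ (k - 1 - b : ℝ) = u ^ (k - 1) * u ^ (-b) := by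
    rw [← Real.rpow_natCast, ← Real.rpow_add hu]
    congr 1
    push_cast [show 1 ≤ k by omega]
    ring
  have e2 : u ^ (k - b : ℝ) = u ^ k * u ^ (-b) := by
    rw [← Real.rpow_natCast, ← Real.rpow_add hu]
    congr 1
  simp only [Pi.add_apply, norm_mul, Real.norm_eq_abs, abs_abs]
  rw [e1, e2, powExpDeriv, abs_mul, Real.abs_exp, abs_of_nonneg (Real.rpow_nonneg hu.le _)]
  calc _ ≤ (|↑k * u ^ (k - 1)| + |u ^ k|) * Real.exp (-u) * u ^ (-b) := by
        gcongr
        exact abs_sub _ _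
    _ = _ := by
        rw [abs_of_nonneg (by positivity), abs_of_nonneg (by positivity)]
        ring

/-- A probability law on `[0, ∞)` with mean one whose tail is positive and regularly varying of
index `-a`, where `1 < a < 2`. -/
structure HasRegularTail (μ : Measure ℝ) (a : ℝ) : Prop where
  prob : IsProbabilityMeasure μ
  nonneg : ∀ᵐ x ∂μ, 0 ≤ x
  mean : ∫ x, x ∂μ = 1
  one_lt : 1 < a
  lt_two : a < 2
  pos : ∀ y, 0 < μ.real (Set.Ioi y)
  tendsto : ∀ c : ℝ, 0 < c →
    Tendsto (fun y => μ.real (Set.Ioi (c * y)) / μ.real (Set.Ioi y)) atTop (𝓝 (c ^ (-a)))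

theorem HasRegularTail.potter {μ : Measure ℝ} {a : ℝ} (h : HasRegularTail μ a) :
    ∃ b C y₀ : ℝ, 1 < b ∧ b < 2 ∧ 0 < C ∧ 0 < y₀ ∧ ∀ y, y₀ ≤ y → ∀ l, 0 < l →
      μ.real (Set.Ioi (l * y)) ≤ C * (l⁻¹ + l ^ (-b)) * μ.real (Set.Ioi y) := by
  have := h.prob
  exact potter_bound (fun _ _ h => measureReal_mono (Set.Ioi_subset_Ioi h)) h.pos
    (fun _ => measureReal_le_one) h.one_lt h.lt_two h.tendsto

/-- Potter's bound at `l = u / s` separates the variables: a function of `u` with finite integral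
when `k ≥ 2`, times a power of `s`. -/
theorem HasRegularTail.powExpDeriv_mul_tail_le {μ : Measure ℝ} {a : ℝ} (h : HasRegularTail μ a) :
    ∃ b C y₀ : ℝ, 1 < b ∧ b < 2 ∧ 0 < C ∧ 0 < y₀ ∧ ∀ (k : ℕ) (y s u : ℝ), y₀ ≤ y → 0 < s → 0 < u →
      |powExpDeriv k u| * μ.real (Set.Ioi (u / s * y)) ≤ C * μ.real (Set.Ioi y) *
        (s * (|powExpDeriv k u| * u ^ (-1 : ℝ)) + s ^ b * (|powExpDeriv k u| * u ^ (-b))) := by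
  obtain ⟨b, C, y₀, hb1, hb2, hC, hy₀, hP⟩ := h.potter
  refine ⟨b, C, y₀, hb1, hb2, hC, hy₀, fun k y s u hy hs hu => ?_⟩
  refine (mul_le_mul_of_nonneg_left (hP y hy (u / s) (by positivity)) (abs_nonneg _)).trans
    (le_of_eq ?_)
  rw [Real.div_rpow hu.le hs.le, Real.rpow_neg hs.le, Real.rpow_neg_one, inv_div, div_inv_eq_mul]
  ring

theorem HasRegularTail.laplaceMoment_bound {μ : Measure ℝ} {a : ℝ} (h : HasRegularTail μ a)
    {k : ℕ} (hk : 2 ≤ k) :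
    ∃ D y₀ : ℝ, 0 < D ∧ 0 < y₀ ∧ ∀ y, y₀ ≤ y → ∀ s, 0 < s →
      laplaceMoment μ k (s / y) / μ.real (Set.Ioi y) ≤ D * (s + s ^ 2) := by
  have := h.prob
  obtain ⟨b, C, y₀, hb1, hb2, hC, hy₀, hP⟩ := h.powExpDeriv_mul_tail_le
  set I := fun c : ℝ => ∫ u in Set.Ioi (0 : ℝ), |powExpDeriv k u| * u ^ (-c)
  have hI : ∀ c, 0 ≤ I c := fun c => setIntegral_nonneg measurableSet_Ioi
    fun u (hu : 0 < u) => by positivity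
  -- The summand `1` only makes the constant visibly positive.
  refine ⟨C * (I 1 + I b) + 1, y₀, by have := hI 1; have := hI b; positivity, hy₀, ?_⟩
  intro y hy s hs
  have hy0 : 0 < y := by linarith
  have hG := h.pos y
  -- As `1 < b < 2`, the power `s ^ b` is below `s` or `s ^ 2`; the final bound no longer involves
  -- `b`.
  have hsb : s ^ b ≤ s + s ^ 2 := by
    rcases le_total s 1 with h1 | h1
    · have := Real.rpow_le_rpow_of_exponent_ge hs h1 hb1.le
      rw [Real.rpow_one] at this
      nlinarith
    · have := Real.rpow_le_rpow_of_exponent_le h1 hb2.le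
      rw [Real.rpow_two] at this
      nlinarith
  have i1 := (integrableOn_abs_powExpDeriv_mul hk one_lt_two).const_mul s
  have i2 := (integrableOn_abs_powExpDeriv_mul hk hb2).const_mul (s ^ b)
  have i3 : IntegrableOn (fun u => C * μ.real (Set.Ioi y) *
      (s * (|powExpDeriv k u| * u ^ (-1 : ℝ)) + s ^ b * (|powExpDeriv k u| * u ^ (-b))))
      (Set.Ioi 0) := (i1.add i2).const_mul (C * μ.real (Set.Ioi y))
  rw [div_le_iff₀ hG, laplaceMoment_eq_integral_tail h.nonneg (by omega) (by positivity)]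
  calc _ ≤ ∫ u in Set.Ioi (0 : ℝ), C * μ.real (Set.Ioi y) *
        (s * (|powExpDeriv k u| * u ^ (-1 : ℝ)) + s ^ b * (|powExpDeriv k u| * u ^ (-b))) := by
        refine (Real.le_norm_self _).trans (norm_integral_le_of_norm_le i3 ?_)
        filter_upwards [ae_restrict_mem measurableSet_Ioi] with u (hu : 0 < u)
        rw [Real.norm_eq_abs, abs_mul, abs_of_nonneg measureReal_nonneg, div_div_eq_mul_div,
          ← div_mul_eq_mul_div]
        exact hP k y s u hy hs hu
    _ = C * μ.real (Set.Ioi y) * (s * I 1 + s ^ b * I b) := by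
        rw [integral_const_mul, integral_add i1 i2, integral_const_mul, integral_const_mul]
    _ ≤ C * μ.real (Set.Ioi y) * ((s + s ^ 2) * I 1 + (s + s ^ 2) * I b) := by
        have := hI 1
        have := hI b
        gcongr
        nlinarith
    _ ≤ _ := by
        have : 0 ≤ (s + s ^ 2) * μ.real (Set.Ioi y) := by positivity
        linarith

/-- In the layer-cake formula the tail ratio tends to `(u / s) ^ (-a)` for each `u`, and the Potter
bound dominates. -/
theorem HasRegularTail.tendsto_laplaceMoment {μ : Measure ℝ} {a : ℝ} (h : HasRegularTail μ a)
    {k : ℕ} (hk : 2 ≤ k) {s : ℝ} (hs : 0 < s) :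
    Tendsto (fun n : ℕ => laplaceMoment μ k (s / n) / μ.real (Set.Ioi (n : ℝ))) atTop
      (𝓝 (a * Real.Gamma (k - a) * s ^ a)) := by
  have := h.prob
  obtain ⟨b, C, y₀, hb1, hb2, hC, hy₀, hP⟩ := h.powExpDeriv_mul_tail_le
  have hlim : a * Real.Gamma (k - a) * s ^ a
      = ∫ u in Set.Ioi (0 : ℝ), powExpDeriv k u * (u / s) ^ (-a) := by
    rw [← integral_powExpDeriv_mul_rpow hk h.lt_two, ← integral_mul_const]
    apply setIntegral_congr_fun measurableSet_Ioi
    intro u (hu : 0 < u)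
    simp only
    rw [Real.div_rpow hu.le hs.le, Real.rpow_neg hs.le a]
    have := (Real.rpow_pos_of_pos hs a).ne'
    field_simp
  have hev : ∀ᶠ n : ℕ in atTop, max y₀ 1 ≤ (n : ℝ) :=
    tendsto_natCast_atTop_atTop.eventually_ge_atTop _
  have heq : (fun n : ℕ => laplaceMoment μ k (s / n) / μ.real (Set.Ioi (n : ℝ))) =ᶠ[atTop]
      fun n : ℕ => ∫ u in Set.Ioi (0 : ℝ), powExpDeriv k u *
        (μ.real (Set.Ioi (u / s * n)) / μ.real (Set.Ioi (n : ℝ))) := by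
    filter_upwards [hev] with n hn
    have hn0 : (0 : ℝ) < n := by linarith [le_max_right y₀ 1]
    rw [laplaceMoment_eq_integral_tail h.nonneg (by omega) (by positivity), ← integral_div]
    congr 1
    ext u
    rw [mul_div_assoc, div_div_eq_mul_div, div_mul_eq_mul_div]
  rw [hlim]
  refine Tendsto.congr' heq.symm ?_
  have i1 := (integrableOn_abs_powExpDeriv_mul hk one_lt_two).const_mul s
  have i2 := (integrableOn_abs_powExpDeriv_mul hk hb2).const_mul (s ^ b)
  refine tendsto_integral_filter_of_dominated_convergence _ ?_ ?_ ((i1.add i2).const_mul C) ?_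
  · filter_upwards with n
    have hm : Antitone fun y => μ.real (Set.Ioi y) :=
      fun _ _ h => measureReal_mono (Set.Ioi_subset_Ioi h)
    have h1 := hm.measurable
    have h2 : Measurable fun u : ℝ => μ.real (Set.Ioi (u / s * n)) :=
      h1.comp (by fun_prop : Measurable fun u : ℝ => u / s * n)
    exact ((continuous_powExpDeriv k).measurable.mul (h2.div_const _)).aestronglyMeasurable
  · filter_upwards [hev] with n hn
    filter_upwards [ae_restrict_mem measurableSet_Ioi] with u (hu : 0 < u)
    have hG := h.pos n
    rw [Real.norm_eq_abs, abs_mul, abs_of_nonneg (a := _ / _) (by positivity)]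
    rw [← mul_div_assoc, div_le_iff₀ hG]
    refine (hP k n s u (le_trans (le_max_left _ _) hn) hs hu).trans (le_of_eq ?_)
    simp only [Pi.add_apply]
    ring
  · filter_upwards [ae_restrict_mem measurableSet_Ioi] with u (hu : 0 < u)
    exact ((h.tendsto (u / s) (by positivity)).comp tendsto_natCast_atTop_atTop).const_mul _

/-! ### Laplace moments of order zero and one -/

namespace HasRegularTail

variable {μ : Measure ℝ} {a : ℝ}

/-- The Bochner integral of a non-integrable function is `0`, so mean one forces integrability. -/
theorem integrable_id (h : HasRegularTail μ a) : Integrable (fun x : ℝ => x) μ := by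
  by_contra hn
  have := h.mean
  rw [integral_undef hn] at this
  exact zero_ne_one this

theorem tendsto_integral_mul_exp (h : HasRegularTail μ a) :
    Tendsto (fun t : ℝ => ∫ x, x * Real.exp (-(t * x)) ∂μ) (𝓝[>] 0) (𝓝 1) := by
  have := h.prob
  rw [← h.mean]
  refine tendsto_integral_filter_of_dominated_convergence (fun x => x) ?_ ?_ h.integrable_id ?_
  · filter_upwards with t
    fun_prop
  · filter_upwards [self_mem_nhdsWithin] with t (ht : 0 < t)
    filter_upwards [h.nonneg] with x hx
    rw [Real.norm_of_nonneg (by positivity)]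
    exact mul_le_of_le_one_right hx (Real.exp_le_one_iff.2 (by nlinarith))
  · filter_upwards with x
    have hc : Continuous fun t : ℝ => x * Real.exp (-(t * x)) := by fun_prop
    have := hc.tendsto 0
    simp only [zero_mul, neg_zero, Real.exp_zero, mul_one] at this
    exact this.mono_left nhdsWithin_le_nhds

theorem laplaceMoment_one_eq (μ : Measure ℝ) (t : ℝ) :
    laplaceMoment μ 1 t = t * ∫ x, x * Real.exp (-(t * x)) ∂μ := by
  rw [laplaceMoment, ← integral_const_mul]
  congr 1
  ext x
  ring

/-- The slope of the Laplace transform at `0` is minus the mean; `1 - e ^ (-t x) ≤ t x` provides the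
domination. -/
theorem tendsto_one_sub_laplaceMoment_zero (h : HasRegularTail μ a) :
    Tendsto (fun t : ℝ => (1 - laplaceMoment μ 0 t) / t) (𝓝[>] 0) (𝓝 1) := by
  have := h.prob
  have heq : (fun t : ℝ => (1 - laplaceMoment μ 0 t) / t)
      =ᶠ[𝓝[>] 0] fun t => ∫ x, (1 - Real.exp (-(t * x))) / t ∂μ := by
    filter_upwards [self_mem_nhdsWithin] with t (ht : 0 < t)
    have hi := integrable_laplaceMoment h.nonneg 0 ht.le
    simp only [pow_zero, one_mul] at hi
    rw [integral_div, integral_sub (integrable_const _) hi]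
    simp [laplaceMoment]
  refine Tendsto.congr' heq.symm ?_
  suffices Tendsto (fun t : ℝ => ∫ x, (1 - Real.exp (-(t * x))) / t ∂μ) (𝓝[>] 0)
      (𝓝 (∫ x, x ∂μ)) by rwa [h.mean] at this
  refine tendsto_integral_filter_of_dominated_convergence (fun x => x) ?_ ?_ h.integrable_id ?_
  · filter_upwards with t
    fun_prop
  · filter_upwards [self_mem_nhdsWithin] with t (ht : 0 < t)
    filter_upwards [h.nonneg] with x hx
    have h1 : Real.exp (-(t * x)) ≤ 1 := Real.exp_le_one_iff.2 (by nlinarith)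
    rw [Real.norm_of_nonneg (div_nonneg (by linarith) ht.le), div_le_iff₀ ht]
    nlinarith [Real.add_one_le_exp (-(t * x))]
  · filter_upwards with x
    have hd : HasDerivAt (fun t : ℝ => -Real.exp (-(t * x))) x 0 := by
      have := (((hasDerivAt_id (0 : ℝ)).mul_const x).neg.exp).neg
      refine this.congr_deriv ?_
      simp
    have := hd.tendsto_slope_zero_right
    refine this.congr fun t => ?_
    simp
    ring

/-- The slope tends to `1 > 1 / 2`, so `M_0 t < 1 - t / 2 ≤ e ^ (-t / 2)` near zero. -/
theorem laplaceMoment_zero_le (h : HasRegularTail μ a) :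
    ∃ T : ℝ, 0 < T ∧ ∀ t, 0 < t → t ≤ T → laplaceMoment μ 0 t ≤ Real.exp (-(t / 2)) := by
  have h1 := h.tendsto_one_sub_laplaceMoment_zero.eventually_const_lt
    (by norm_num : (1 / 2 : ℝ) < 1)
  obtain ⟨T, hT, hT'⟩ := mem_nhdsGT_iff_exists_Ioc_subset.1 h1
  refine ⟨T, hT, fun t ht htT => ?_⟩
  have h2 : 1 / 2 < (1 - laplaceMoment μ 0 t) / t := hT' ⟨ht, htT⟩
  rw [lt_div_iff₀ ht] at h2
  linarith [Real.add_one_le_exp (-(t / 2))]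

theorem laplaceMoment_zero_antitone (h : HasRegularTail μ a) {s t : ℝ} (hs : 0 < s) (hst : s ≤ t) :
    laplaceMoment μ 0 t ≤ laplaceMoment μ 0 s := by
  have := h.prob
  apply integral_mono_ae (integrable_laplaceMoment h.nonneg 0 (by linarith))
    (integrable_laplaceMoment h.nonneg 0 hs.le)
  filter_upwards [h.nonneg] with x hx
  simp only [pow_zero, one_mul, Real.exp_le_exp]
  nlinarith

theorem tendsto_div_natCast {s : ℝ} (hs : 0 < s) :
    Tendsto (fun n : ℕ => s / (n : ℝ)) atTop (𝓝[>] 0) := by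
  rw [tendsto_nhdsWithin_iff]
  refine ⟨tendsto_const_div_atTop_nhds_zero_nat s, ?_⟩
  filter_upwards [eventually_gt_atTop 0] with n hn
  have : (0 : ℝ) < n := by exact_mod_cast hn
  exact div_pos hs this

theorem tendsto_natCast_mul_laplaceMoment_one (h : HasRegularTail μ a) {s : ℝ} (hs : 0 < s) :
    Tendsto (fun n : ℕ => (n : ℝ) * laplaceMoment μ 1 (s / n)) atTop (𝓝 s) := by
  have h1 := (h.tendsto_integral_mul_exp.comp (tendsto_div_natCast hs)).const_mul s
  rw [mul_one] at h1
  refine h1.congr' ?_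
  filter_upwards [eventually_gt_atTop 0] with n hn
  have : (0 : ℝ) < n := by exact_mod_cast hn
  rw [laplaceMoment_one_eq]
  simp only [Function.comp]
  field_simp

theorem laplaceMoment_one_le (h : HasRegularTail μ a) {t : ℝ} (ht : 0 < t) :
    laplaceMoment μ 1 t ≤ t := by
  rw [laplaceMoment_one_eq]
  refine mul_le_of_le_one_right ht.le ?_
  rw [← h.mean]
  refine integral_mono_of_nonneg ?_ h.integrable_id ?_
  · filter_upwards [h.nonneg] with x hx
    simp only [Pi.zero_apply]
    positivity
  · filter_upwards [h.nonneg] with x hx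
    exact mul_le_of_le_one_right hx (Real.exp_le_one_iff.2 (by nlinarith))

theorem tendsto_laplaceMoment_zero_pow (h : HasRegularTail μ a) {s : ℝ} (hs : 0 < s) (r : ℕ) :
    Tendsto (fun n : ℕ => laplaceMoment μ 0 (s / n) ^ (n - r)) atTop (𝓝 (Real.exp (-s))) := by
  have h1 := h.tendsto_one_sub_laplaceMoment_zero.comp (tendsto_div_natCast hs)
  have h2 : Tendsto (fun n : ℕ => (n : ℝ) * (laplaceMoment μ 0 (s / n) - 1)) atTop (𝓝 (-s)) := by
    have := h1.const_mul (-s)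
    rw [mul_one] at this
    refine this.congr' ?_
    filter_upwards [eventually_gt_atTop 0] with n hn
    have : (0 : ℝ) < n := by exact_mod_cast hn
    simp only [Function.comp]
    field_simp
    ring
  have h3 := Real.tendsto_one_add_pow_exp_of_tendsto h2
  simp only [add_sub_cancel] at h3
  have h4 : Tendsto (fun n : ℕ => laplaceMoment μ 0 (s / n)) atTop (𝓝 1) := by
    have h5 := h2.mul tendsto_inv_atTop_nhds_zero_nat
    have h6 := h5.add_const 1
    rw [mul_zero, zero_add] at h6
    refine h6.congr' ?_
    filter_upwards [eventually_gt_atTop 0] with n hn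
    have : (0 : ℝ) < n := by exact_mod_cast hn
    field_simp
    ring
  -- The `r` missing factors of the `n`-th power each tend to `1`.
  have h5 := h3.div (h4.pow r) (by simp)
  rw [one_pow, div_one] at h5
  refine h5.congr' ?_
  filter_upwards [eventually_ge_atTop r, h4.eventually_ne one_ne_zero] with n hn hne
  simp only [Pi.div_apply]
  rw [div_eq_iff (pow_ne_zero _ hne), ← pow_add, Nat.sub_add_cancel hn]

end HasRegularTail

/-! ### Laplace representation of self-normalized moments -/

theorem integrableOn_pow_mul_exp_neg_mul {K : ℕ} (hK : 1 ≤ K) {S : ℝ} (hS : 0 < S) :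
    IntegrableOn (fun t : ℝ => t ^ (K - 1) * Real.exp (-(S * t))) (Set.Ioi 0) := by
  have hK0 : (0 : ℝ) < K := by exact_mod_cast hK
  have h := Real.integral_rpow_mul_exp_neg_mul_Ioi hK0 hS
  have hi : IntegrableOn (fun t : ℝ => t ^ ((K : ℝ) - 1) * Real.exp (-(S * t))) (Set.Ioi 0) :=
    -- A nonzero Bochner integral certifies integrability.
    .of_integral_ne_zero (by rw [h]; have := Real.Gamma_pos_of_pos hK0; positivity)
  have e : ((K : ℝ) - 1) = ((K - 1 : ℕ) : ℝ) := by push_cast [hK]; ring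
  simpa only [e, Real.rpow_natCast] using hi

theorem integral_pow_mul_exp_neg_mul {K : ℕ} (hK : 1 ≤ K) {S : ℝ} (hS : 0 < S) :
    ∫ t in Set.Ioi (0 : ℝ), t ^ (K - 1) * Real.exp (-(S * t)) = Real.Gamma K / S ^ K := by
  have hK0 : (0 : ℝ) < K := by exact_mod_cast hK
  have h := Real.integral_rpow_mul_exp_neg_mul_Ioi hK0 hS
  have e : ((K : ℝ) - 1) = ((K - 1 : ℕ) : ℝ) := by push_cast [hK]; ring
  simp only [e, Real.rpow_natCast] at h
  rw [h, one_div, inv_pow, mul_comm, div_eq_mul_inv]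

section Product

variable {ι : Type*} [Fintype ι]

theorem inv_mul_prod_eq {κ : ι → ℕ} (hκ : 1 ≤ ∑ l, κ l) (z : ι → ℝ) {t : ℝ} (ht : 0 < t) :
    t⁻¹ * ∏ l, ((t * z l) ^ κ l * Real.exp (-(t * z l)))
      = (∏ l, z l ^ κ l) * (t ^ (∑ l, κ l - 1) * Real.exp (-((∑ l, z l) * t))) := by
  simp only [mul_pow]
  rw [Finset.prod_mul_distrib, Finset.prod_mul_distrib, Finset.prod_pow_eq_pow_sum,
    ← Real.exp_sum, Finset.sum_neg_distrib, ← Finset.mul_sum, mul_comm (∑ l, z l)]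
  obtain ⟨m, hm⟩ := Nat.exists_eq_add_of_le' hκ
  rw [hm, Nat.add_sub_cancel, pow_succ]
  field_simp

/-- Covers the degenerate event of a zero denominator, where both sides of the Gamma identity
vanish. -/
theorem prod_pow_eq_zero_of_sum_eq_zero {κ : ι → ℕ} (hκ : 1 ≤ ∑ l, κ l) {z : ι → ℝ}
    (hz : ∀ l, 0 ≤ z l) (hS : ∑ l, z l = 0) : ∏ l, z l ^ κ l = 0 := by
  obtain ⟨l, -, hl⟩ := Finset.exists_ne_zero_of_sum_ne_zero (by omega : ∑ l, κ l ≠ 0)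
  refine Finset.prod_eq_zero (Finset.mem_univ l) ?_
  rw [(Finset.sum_eq_zero_iff_of_nonneg fun l _ => hz l).1 hS l (Finset.mem_univ l), zero_pow hl]

theorem prod_div_sum_pow (κ : ι → ℕ) (z : ι → ℝ) :
    ∏ l, (z l / ∑ j, z j) ^ κ l = (∏ l, z l ^ κ l) / (∑ j, z j) ^ (∑ l, κ l) := by
  simp only [div_pow, Finset.prod_div_distrib, Finset.prod_pow_eq_pow_sum]

theorem integrableOn_inv_mul_prod {κ : ι → ℕ} (hκ : 1 ≤ ∑ l, κ l) {z : ι → ℝ}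
    (hz : ∀ l, 0 ≤ z l) :
    IntegrableOn (fun t : ℝ => t⁻¹ * ∏ l, ((t * z l) ^ κ l * Real.exp (-(t * z l))))
      (Set.Ioi 0) := by
  rw [integrableOn_congr_fun (s := Set.Ioi 0) (fun t ht => inv_mul_prod_eq hκ z ht)
    measurableSet_Ioi]
  rcases (Finset.sum_nonneg fun l _ => hz l).eq_or_lt' with h0 | h0
  · rw [prod_pow_eq_zero_of_sum_eq_zero hκ hz h0]
    simp
  · exact (integrableOn_pow_mul_exp_neg_mul hκ h0).const_mul _

theorem integral_inv_mul_prod {κ : ι → ℕ} (hκ : 1 ≤ ∑ l, κ l) {z : ι → ℝ} (hz : ∀ l, 0 ≤ z l) :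
    ∫ t in Set.Ioi (0 : ℝ), t⁻¹ * ∏ l, ((t * z l) ^ κ l * Real.exp (-(t * z l)))
      = Real.Gamma (∑ l, κ l : ℕ) * ∏ l, (z l / ∑ j, z j) ^ κ l := by
  rw [setIntegral_congr_fun measurableSet_Ioi fun t (ht : 0 < t) => inv_mul_prod_eq hκ z ht,
    integral_const_mul, prod_div_sum_pow]
  rcases (Finset.sum_nonneg fun l _ => hz l).eq_or_lt' with h0 | h0
  · rw [prod_pow_eq_zero_of_sum_eq_zero hκ hz h0]
    simp
  · rw [integral_pow_mul_exp_neg_mul hκ h0]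
    ring

theorem prod_div_sum_pow_mem_Icc (κ : ι → ℕ) {z : ι → ℝ} (hz : ∀ l, 0 ≤ z l) :
    ∏ l, (z l / ∑ j, z j) ^ κ l ∈ Set.Icc (0 : ℝ) 1 := by
  have hS : 0 ≤ ∑ j, z j := Finset.sum_nonneg fun l _ => hz l
  have h0 : ∀ l, 0 ≤ z l / ∑ j, z j := fun l => div_nonneg (hz l) hS
  refine ⟨Finset.prod_nonneg fun l _ => pow_nonneg (h0 l) _,
    Finset.prod_le_one (fun l _ => pow_nonneg (h0 l) _) fun l _ => pow_le_one₀ (h0 l) ?_⟩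
  exact div_le_one_of_le₀ (Finset.single_le_sum (fun j _ => hz j) (Finset.mem_univ l)) hS

variable {Ω : Type*} [MeasurableSpace Ω] {P : Measure Ω}
  {Z : ι → Ω → ℝ} {μ : Measure ℝ}

theorem integral_prod_eq_prod_laplaceMoment (hZ : ∀ l, AEMeasurable (Z l) P)
    (hlaw : ∀ l, P.map (Z l) = μ) (hindep : iIndepFun Z P) (κ : ι → ℕ) (t : ℝ) :
    ∫ ω, ∏ l, ((t * Z l ω) ^ κ l * Real.exp (-(t * Z l ω))) ∂P
      = ∏ l, laplaceMoment μ (κ l) t := by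
  have hm : ∀ l, Measurable fun x : ℝ => (t * x) ^ κ l * Real.exp (-(t * x)) := fun l => by fun_prop
  rw [hindep.integral_fun_prod_comp (f := fun l x => (t * x) ^ κ l * Real.exp (-(t * x))) hZ
    fun l => (hm l).aestronglyMeasurable]
  refine Finset.prod_congr rfl fun l _ => ?_
  rw [laplaceMoment, ← hlaw l, integral_map (hZ l) (hm l).aestronglyMeasurable]

/-- Integrating the nonnegative kernel in `t` first leaves a constant times a product of ratios in
`[0, 1]`, which is integrable. -/
theorem integrable_prod_laplace [IsProbabilityMeasure P]
    (hZ : ∀ l, AEMeasurable (Z l) P) (hZ0 : ∀ l ω, 0 ≤ Z l ω)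
    {κ : ι → ℕ} (hκ : 1 ≤ ∑ l, κ l) :
    Integrable (fun p : Ω × ℝ => p.2⁻¹ * ∏ l, ((p.2 * Z l p.1) ^ κ l * Real.exp (-(p.2 * Z l p.1))))
      (P.prod (volume.restrict (Set.Ioi 0))) := by
  have hm : AEMeasurable
      (fun p : Ω × ℝ => p.2⁻¹ * ∏ l, ((p.2 * Z l p.1) ^ κ l * Real.exp (-(p.2 * Z l p.1))))
      (P.prod (volume.restrict (Set.Ioi 0))) := by
    have h1 : ∀ l, AEMeasurable (fun p : Ω × ℝ => Z l p.1) (P.prod (volume.restrict (Set.Ioi 0))) :=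
      fun l => (hZ l).comp_fst
    have h2 : ∀ l, AEMeasurable
        (fun p : Ω × ℝ => (p.2 * Z l p.1) ^ κ l * Real.exp (-(p.2 * Z l p.1)))
        (P.prod (volume.restrict (Set.Ioi 0))) := fun l => by
      have := h1 l
      fun_prop
    exact (measurable_snd.inv.aemeasurable).mul (Finset.univ.aemeasurable_fun_prod fun l _ => h2 l)
  rw [integrable_prod_iff hm.aestronglyMeasurable]
  have hi : ∀ ω, Integrable (fun t : ℝ =>
      t⁻¹ * ∏ l, ((t * Z l ω) ^ κ l * Real.exp (-(t * Z l ω)))) (volume.restrict (Set.Ioi 0)) :=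
    fun ω => integrableOn_inv_mul_prod hκ fun l => hZ0 l ω
  refine ⟨ae_of_all _ hi, ?_⟩
  have hn : ∀ ω, ∫ t in Set.Ioi (0 : ℝ),
      ‖t⁻¹ * ∏ l, ((t * Z l ω) ^ κ l * Real.exp (-(t * Z l ω)))‖
      = Real.Gamma (∑ l, κ l : ℕ) * ∏ l, (Z l ω / ∑ j, Z j ω) ^ κ l := by
    intro ω
    rw [← integral_inv_mul_prod hκ fun l => hZ0 l ω]
    refine setIntegral_congr_fun measurableSet_Ioi fun t (ht : 0 < t) => ?_
    refine Real.norm_of_nonneg (mul_nonneg (by positivity) (Finset.prod_nonneg fun l _ => ?_))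
    have := hZ0 l ω
    positivity
  simp only [hn]
  have hb : Integrable (fun ω => ∏ l, (Z l ω / ∑ j, Z j ω) ^ κ l) P := by
    refine Integrable.of_bound ?_ 1 ?_
    · refine AEMeasurable.aestronglyMeasurable (Finset.univ.aemeasurable_fun_prod fun l _ => ?_)
      exact ((hZ l).div (Finset.univ.aemeasurable_fun_sum fun j _ => hZ j)).pow_const _
    · refine ae_of_all _ fun ω => ?_
      have := prod_div_sum_pow_mem_Icc κ fun l => hZ0 l ω
      rw [Real.norm_of_nonneg this.1]
      exact this.2
  exact hb.const_mul _

/-- The Laplace-transform formula for the mixed moments of self-normalized variables. -/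
theorem Gamma_mul_integral_prod_div_sum [IsProbabilityMeasure P]
    (hZ : ∀ l, AEMeasurable (Z l) P) (hZ0 : ∀ l ω, 0 ≤ Z l ω)
    (hlaw : ∀ l, P.map (Z l) = μ) (hindep : iIndepFun Z P) {κ : ι → ℕ} (hκ : 1 ≤ ∑ l, κ l) :
    IntegrableOn (fun t => t⁻¹ * ∏ l, laplaceMoment μ (κ l) t) (Set.Ioi 0) ∧
    ∫ t in Set.Ioi (0 : ℝ), t⁻¹ * ∏ l, laplaceMoment μ (κ l) t
      = Real.Gamma (∑ l, κ l : ℕ) * ∫ ω, ∏ l, (Z l ω / ∑ j, Z j ω) ^ κ l ∂P := by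
  have hint := integrable_prod_laplace hZ hZ0 hκ
  have e : ∀ t : ℝ, ∫ ω, t⁻¹ * ∏ l, ((t * Z l ω) ^ κ l * Real.exp (-(t * Z l ω))) ∂P
      = t⁻¹ * ∏ l, laplaceMoment μ (κ l) t := fun t => by
    rw [integral_const_mul, integral_prod_eq_prod_laplaceMoment hZ hlaw hindep]
  constructor
  · have h1 := hint.integral_prod_right
    simp only [e] at h1
    exact h1
  · simp only [← e]
    rw [← integral_integral_swap (f := fun ω t =>
      t⁻¹ * ∏ l, ((t * Z l ω) ^ κ l * Real.exp (-(t * Z l ω)))) hint, ← integral_const_mul]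
    congr 1
    ext ω
    exact integral_inv_mul_prod hκ fun l => hZ0 l ω

end Product

/-! ### Passage to the limit in the Laplace integral -/

namespace HasRegularTail

variable {μ : Measure ℝ} {a : ℝ}

/-- The normalization under which the `k`-th Laplace moment at `s / n` converges. -/
noncomputable def momentWeight (μ : Measure ℝ) (n k : ℕ) : ℝ :=
  if k = 1 then n else (μ.real (Set.Ioi (n : ℝ)))⁻¹

/-- The exponent of the limit of the normalized `k`-th Laplace moment. -/
noncomputable def limitExponent (a : ℝ) (k : ℕ) : ℝ := if k = 1 then 1 else a

/-- The constant in the limit of the normalized `k`-th Laplace moment. -/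
noncomputable def limitConst (a : ℝ) (k : ℕ) : ℝ := if k = 1 then 1 else a * Real.Gamma (k - a)

theorem momentWeight_nonneg (μ : Measure ℝ) (n k : ℕ) : 0 ≤ momentWeight μ n k := by
  unfold momentWeight
  split_ifs <;> positivity

theorem tendsto_momentWeight_mul (h : HasRegularTail μ a) {k : ℕ} (hk : 1 ≤ k) {s : ℝ}
    (hs : 0 < s) :
    Tendsto (fun n : ℕ => momentWeight μ n k * laplaceMoment μ k (s / n)) atTop
      (𝓝 (limitConst a k * s ^ limitExponent a k)) := by
  unfold momentWeight limitConst limitExponent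
  split_ifs with h1
  · subst h1
    simpa using h.tendsto_natCast_mul_laplaceMoment_one hs
  · simpa only [div_eq_inv_mul _ (μ.real _)] using h.tendsto_laplaceMoment (by omega : 2 ≤ k) hs

theorem momentWeight_mul_le (h : HasRegularTail μ a) {k : ℕ} (hk : 1 ≤ k) :
    ∃ D : ℝ, 0 < D ∧ ∀ᶠ n : ℕ in atTop, ∀ s, 0 < s →
      momentWeight μ n k * laplaceMoment μ k (s / n) ≤ D * (s + s ^ 2) := by
  unfold momentWeight
  split_ifs with h1
  · subst h1
    refine ⟨1, one_pos, ?_⟩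
    filter_upwards [eventually_gt_atTop 0] with n hn s hs
    have hn0 : (0 : ℝ) < n := by exact_mod_cast hn
    have h2 := h.laplaceMoment_one_le (div_pos hs hn0)
    rw [le_div_iff₀' hn0] at h2
    nlinarith
  · obtain ⟨D, y₀, hD, -, hb⟩ := h.laplaceMoment_bound (by omega : 2 ≤ k)
    refine ⟨D, hD, ?_⟩
    filter_upwards [tendsto_natCast_atTop_atTop.eventually_ge_atTop y₀] with n hn s hs
    rw [← div_eq_inv_mul]
    exact hb n hn s hs

theorem momentWeight_le (h : HasRegularTail μ a) (k : ℕ) :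
    ∃ A : ℝ, 0 < A ∧ ∀ᶠ n : ℕ in atTop, momentWeight μ n k ≤ A * (n : ℝ) ^ 2 := by
  unfold momentWeight
  split_ifs with h1
  · refine ⟨1, one_pos, ?_⟩
    filter_upwards [eventually_ge_atTop 1] with n hn
    have hn1 : (1 : ℝ) ≤ n := by exact_mod_cast hn
    nlinarith
  · obtain ⟨b, C, y₀, hb1, hb2, hC, hy₀, hP⟩ := h.potter
    have hG1 := h.pos 1
    refine ⟨2 * C / μ.real (Set.Ioi 1), by positivity, ?_⟩
    filter_upwards [tendsto_natCast_atTop_atTop.eventually_ge_atTop y₀,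
      eventually_ge_atTop 1] with n hn hn'
    have hn1 : (1 : ℝ) ≤ n := by exact_mod_cast hn'
    have hGn := h.pos n
    -- The choice `l = 1 / n` compares `G n` with the fixed value `G 1`.
    have h2 := hP n hn (n : ℝ)⁻¹ (by positivity)
    rw [inv_mul_cancel₀ (by positivity), inv_inv, Real.inv_rpow (by positivity),
      Real.rpow_neg (by positivity), inv_inv] at h2
    have h3 : (n : ℝ) ^ b ≤ n ^ 2 := by
      rw [← Real.rpow_two]
      exact Real.rpow_le_rpow_of_exponent_le hn1 hb2.le
    rw [inv_le_iff_one_le_mul₀ hGn, div_mul_eq_mul_div, div_mul_eq_mul_div, one_le_div hG1]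
    refine h2.trans (mul_le_mul_of_nonneg_right ?_ hGn.le)
    have h4 : (n : ℝ) + n ^ b ≤ 2 * n ^ 2 := by nlinarith
    nlinarith

section Limit

variable {r : ℕ} {k : Fin r → ℕ}

theorem prod_momentWeight_le (h : HasRegularTail μ a) (k : Fin r → ℕ) :
    ∃ A : ℝ, ∀ᶠ n : ℕ in atTop, ∏ i, momentWeight μ n (k i) ≤ A * (n : ℝ) ^ (2 * r) := by
  choose A hA hAn using fun i => h.momentWeight_le (k i)
  refine ⟨∏ i, A i, ?_⟩
  filter_upwards [eventually_all.2 hAn] with n hn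
  calc ∏ i, momentWeight μ n (k i) ≤ ∏ i, (A i * (n : ℝ) ^ 2) :=
        Finset.prod_le_prod (fun i _ => momentWeight_nonneg _ _ _) fun i _ => hn i
    _ = _ := by rw [Finset.prod_mul_distrib]; simp [pow_mul]

/-- Beyond `T` the factor `M_0 ^ (n - r)` is at most `q ^ (n - r)` with `q < 1`, against weights of
order at most `n ^ (2 r)`. -/
theorem tendsto_tail_part (h : HasRegularTail μ a) (k : Fin r → ℕ)
    (hint : IntegrableOn (fun t => t⁻¹ * ∏ i, laplaceMoment μ (k i) t) (Set.Ioi 0))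
    {T : ℝ} (hT : 0 < T) (hφ : laplaceMoment μ 0 T ≤ Real.exp (-(T / 2))) :
    Tendsto (fun n : ℕ => (∏ i, momentWeight μ n (k i)) * ∫ t in Set.Ioi T,
      (t⁻¹ * ∏ i, laplaceMoment μ (k i) t) * laplaceMoment μ 0 t ^ (n - r)) atTop (𝓝 0) := by
  have := h.prob
  set F := fun t => t⁻¹ * ∏ i, laplaceMoment μ (k i) t with hF
  set q := Real.exp (-(T / 2)) with hq
  have hq0 : 0 < q := Real.exp_pos _
  have hq1 : q < 1 := Real.exp_lt_one_iff.2 (by linarith)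
  have hF0 : ∀ t, 0 < t → 0 ≤ F t := fun t ht => mul_nonneg (by positivity)
    (Finset.prod_nonneg fun i _ => laplaceMoment_nonneg h.nonneg _ ht.le)
  have hint' : IntegrableOn F (Set.Ioi T) := hint.mono_set (Set.Ioi_subset_Ioi hT.le)
  set I := ∫ t in Set.Ioi T, F t
  have hI : 0 ≤ I := setIntegral_nonneg measurableSet_Ioi fun t (ht : T < t) => hF0 t (hT.trans ht)
  obtain ⟨A, hA⟩ := h.prod_momentWeight_le k
  have hlim : Tendsto (fun n : ℕ => A * I * (q ^ r)⁻¹ * ((n : ℝ) ^ (2 * r) * q ^ n))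
      atTop (𝓝 0) := by
    simpa using (tendsto_pow_const_mul_const_pow_of_lt_one (2 * r) hq0.le hq1).const_mul
      (A * I * (q ^ r)⁻¹)
  refine tendsto_of_tendsto_of_tendsto_of_le_of_le' tendsto_const_nhds hlim ?_ ?_
  · filter_upwards with n
    refine mul_nonneg (Finset.prod_nonneg fun i _ => momentWeight_nonneg _ _ _)
      (setIntegral_nonneg measurableSet_Ioi fun t (ht : T < t) => ?_)
    exact mul_nonneg (hF0 t (hT.trans ht))
      (pow_nonneg (laplaceMoment_nonneg h.nonneg _ (hT.trans ht).le) _)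
  · filter_upwards [hA, eventually_ge_atTop r] with n hn hnr
    have h1 : ∫ t in Set.Ioi T, F t * laplaceMoment μ 0 t ^ (n - r) ≤ I * q ^ (n - r) := by
      rw [← integral_mul_const]
      refine integral_mono_of_nonneg ?_ (hint'.mul_const _) ?_
      · filter_upwards [ae_restrict_mem measurableSet_Ioi] with t (ht : T < t)
        exact mul_nonneg (hF0 t (hT.trans ht))
          (pow_nonneg (laplaceMoment_nonneg h.nonneg _ (hT.trans ht).le) _)
      · filter_upwards [ae_restrict_mem measurableSet_Ioi] with t (ht : T < t)
        refine mul_le_mul_of_nonneg_left (pow_le_pow_left₀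
          (laplaceMoment_nonneg h.nonneg _ (hT.trans ht).le) ?_ _) (hF0 t (hT.trans ht))
        exact (h.laplaceMoment_zero_antitone hT ht.le).trans hφ
    have hW : 0 ≤ ∏ i, momentWeight μ n (k i) :=
      Finset.prod_nonneg fun i _ => momentWeight_nonneg _ _ _
    calc _ ≤ (∏ i, momentWeight μ n (k i)) * (I * q ^ (n - r)) := by gcongr
      _ ≤ (A * (n : ℝ) ^ (2 * r)) * (I * q ^ (n - r)) := by gcongr
      _ = _ := by
        rw [pow_sub₀ _ hq0.ne' hnr]
        ring

/-- Since `r ≥ 1`, a factor `s` cancels `s⁻¹`, and the binomial expansion leaves finitely many Gamma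
integrals. -/
theorem integrableOn_bound {r : ℕ} (hr : 1 ≤ r) {c : ℝ} (hc : 0 < c) :
    IntegrableOn (fun s : ℝ => s⁻¹ * (s + s ^ 2) ^ r * Real.exp (-(c * s))) (Set.Ioi 0) := by
  have h1 : IntegrableOn (fun s : ℝ => ∑ m ∈ Finset.range (r + 1),
      (r.choose m : ℝ) * (s ^ (r + m - 1) * Real.exp (-(c * s)))) (Set.Ioi 0) :=
    integrable_finsetSum _ fun m _ =>
      (integrableOn_pow_mul_exp_neg_mul (K := r + m) (by omega) hc).const_mul _
  refine h1.congr_fun (fun s (hs : 0 < s) => ?_) measurableSet_Ioi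
  simp only
  rw [show s + s ^ 2 = s * (s + 1) by ring, mul_pow, add_pow, Finset.mul_sum, Finset.mul_sum,
    Finset.sum_mul]
  refine Finset.sum_congr rfl fun m _ => ?_
  obtain ⟨p, rfl⟩ := Nat.exists_eq_add_of_le' hr
  rw [show p + 1 + m - 1 = p + m by omega, pow_succ, pow_add]
  field_simp
  simp

theorem limitExponent_pos (h : HasRegularTail μ a) (k : ℕ) : 0 < limitExponent a k := by
  have := h.one_lt
  unfold limitExponent
  split_ifs <;> linarith

theorem integral_limit (h : HasRegularTail μ a) (hr : 1 ≤ r) (k : Fin r → ℕ) :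
    ∫ s in Set.Ioi (0 : ℝ),
        s⁻¹ * (∏ i, (limitConst a (k i) * s ^ limitExponent a (k i))) * Real.exp (-s)
      = (∏ i, limitConst a (k i)) * Real.Gamma (∑ i, limitExponent a (k i)) := by
  have : NeZero r := ⟨by omega⟩
  have hpos : 0 < ∑ i, limitExponent a (k i) :=
    Finset.sum_pos (fun i _ => h.limitExponent_pos _) Finset.univ_nonempty
  rw [← sub_add_cancel (∑ i, limitExponent a (k i)) 1,
    ← integral_rpow_mul_exp_neg (by linarith), ← integral_const_mul]
  refine setIntegral_congr_fun measurableSet_Ioi fun s (hs : 0 < s) => ?_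
  rw [Finset.prod_mul_distrib, ← Real.rpow_sum_of_pos hs, Real.rpow_sub_one hs.ne']
  ring

theorem tendsto_main_part (h : HasRegularTail μ a) (hr : 1 ≤ r) (hk : ∀ i, 1 ≤ k i)
    {T : ℝ} (hT : 0 < T)
    (hφ : ∀ t, 0 < t → t ≤ T → laplaceMoment μ 0 t ≤ Real.exp (-(t / 2))) :
    Tendsto (fun n : ℕ => (∏ i, momentWeight μ n (k i)) * ∫ t in Set.Ioc 0 T,
      (t⁻¹ * ∏ i, laplaceMoment μ (k i) t) * laplaceMoment μ 0 t ^ (n - r)) atTop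
      (𝓝 ((∏ i, limitConst a (k i)) * Real.Gamma (∑ i, limitExponent a (k i)))) := by
  have := h.prob
  choose D hD hDn using fun i => h.momentWeight_mul_le (hk i)
  set f : ℕ → ℝ → ℝ := fun n s => if s / n ≤ T then
    s⁻¹ * (∏ i, (momentWeight μ n (k i) * laplaceMoment μ (k i) (s / n)))
      * laplaceMoment μ 0 (s / n) ^ (n - r) else 0 with hf
  -- Under `t = s / n` the measure `dt / t` is invariant; only the cutoff `t ≤ T` changes, to `s / n
  -- ≤ T`.
  have heq : ∀ᶠ n : ℕ in atTop, ∫ s in Set.Ioi (0 : ℝ), f n s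
      = (∏ i, momentWeight μ n (k i)) * ∫ t in Set.Ioc 0 T,
        (t⁻¹ * ∏ i, laplaceMoment μ (k i) t) * laplaceMoment μ 0 t ^ (n - r) := by
    filter_upwards [eventually_gt_atTop 0] with n hn
    have hn0 : (0 : ℝ) < n := by exact_mod_cast hn
    have h1 := integral_comp_mul_left_Ioi ((Set.Iic T).indicator fun t =>
      (t⁻¹ * ∏ i, laplaceMoment μ (k i) t) * laplaceMoment μ 0 t ^ (n - r)) 0 (inv_pos.2 hn0)
    rw [mul_zero, setIntegral_indicator measurableSet_Iic, Set.Ioi_inter_Iic, inv_inv,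
      smul_eq_mul] at h1
    rw [← mul_right_inj' hn0.ne', mul_left_comm, ← h1, ← integral_const_mul, ← integral_const_mul]
    refine setIntegral_congr_fun measurableSet_Ioi fun s (hs : 0 < s) => ?_
    simp only [hf, Set.indicator_apply, Set.mem_Iic, inv_mul_eq_div]
    split_ifs
    · rw [Finset.prod_mul_distrib]
      field_simp
    · simp
  refine Tendsto.congr' heq ?_
  rw [← h.integral_limit hr k]
  refine tendsto_integral_filter_of_dominated_convergence
    (fun s => (∏ i, D i) * (s⁻¹ * (s + s ^ 2) ^ r * Real.exp (-(1 / 4 * s)))) ?_ ?_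
    ((integrableOn_bound hr (by norm_num)).const_mul _) ?_
  · filter_upwards with n
    apply Measurable.aestronglyMeasurable
    have hM : ∀ j, Measurable fun s : ℝ => laplaceMoment μ j (s / n) := fun j =>
      (measurable_laplaceMoment μ j).comp (measurable_id.div_const _)
    refine Measurable.ite (measurableSet_le (by fun_prop) measurable_const) ?_ measurable_const
    exact (measurable_inv.mul (Finset.univ.measurable_fun_prod fun i _ =>
      (hM (k i)).const_mul _)).mul ((hM 0).pow_const _)
  · filter_upwards [eventually_all.2 hDn, eventually_ge_atTop (2 * r), eventually_gt_atTop 0]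
      with n hn hnr hn'
    have hn0 : (0 : ℝ) < n := by exact_mod_cast hn'
    filter_upwards [ae_restrict_mem measurableSet_Ioi] with s (hs : 0 < s)
    have hsn : 0 < s / n := div_pos hs hn0
    have hnn : ∀ i, 0 ≤ momentWeight μ n (k i) * laplaceMoment μ (k i) (s / n) := fun i =>
      mul_nonneg (momentWeight_nonneg _ _ _) (laplaceMoment_nonneg h.nonneg _ hsn.le)
    have hb0 : 0 ≤ (∏ i, D i) * (s⁻¹ * (s + s ^ 2) ^ r * Real.exp (-(1 / 4 * s))) := by
      have := Finset.prod_nonneg fun i (_ : i ∈ Finset.univ) => (hD i).le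
      positivity
    simp only [hf]
    split_ifs with hsT
    swap
    · simpa using hb0
    have hφ0 := laplaceMoment_nonneg h.nonneg 0 hsn.le
    have hp0 : 0 ≤ ∏ i, momentWeight μ n (k i) * laplaceMoment μ (k i) (s / n) :=
      Finset.prod_nonneg fun i _ => hnn i
    rw [Real.norm_of_nonneg (by positivity)]
    have e1 : ∏ i, momentWeight μ n (k i) * laplaceMoment μ (k i) (s / n)
        ≤ (∏ i, D i) * (s + s ^ 2) ^ r := by
      refine (Finset.prod_le_prod (fun i _ => hnn i) fun i _ => hn i s hs).trans (le_of_eq ?_)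
      rw [Finset.prod_mul_distrib]
      simp
    -- For `n ≥ 2 r` one has `n - r ≥ n / 2`, so the exponent `(n - r) s / (2 n)` is at least `s /
    -- 4`.
    have e2 : laplaceMoment μ 0 (s / n) ^ (n - r) ≤ Real.exp (-(1 / 4 * s)) := by
      refine (pow_le_pow_left₀ hφ0 (hφ _ hsn hsT) _).trans ?_
      rw [← Real.exp_nat_mul, Real.exp_le_exp]
      have h2 : (n : ℝ) / 2 ≤ ((n - r : ℕ) : ℝ) := by
        rw [div_le_iff₀ two_pos]
        exact_mod_cast (by omega : n ≤ (n - r) * 2)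
      have h3 : (n : ℝ) / 2 * (s / n / 2) ≤ ((n - r : ℕ) : ℝ) * (s / n / 2) := by gcongr
      have h4 : (n : ℝ) / 2 * (s / n / 2) = 1 / 4 * s := by
        field_simp
        norm_num
      linarith
    have hD0 := Finset.prod_nonneg fun i (_ : i ∈ Finset.univ) => (hD i).le
    calc _ ≤ s⁻¹ * ((∏ i, D i) * (s + s ^ 2) ^ r) * Real.exp (-(1 / 4 * s)) := by gcongr
      _ = _ := by ring
  · filter_upwards [ae_restrict_mem measurableSet_Ioi] with s (hs : 0 < s)
    have h1 : Tendsto (fun n : ℕ =>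
        s⁻¹ * (∏ i, (momentWeight μ n (k i) * laplaceMoment μ (k i) (s / n)))
          * laplaceMoment μ 0 (s / n) ^ (n - r)) atTop
        (𝓝 (s⁻¹ * (∏ i, (limitConst a (k i) * s ^ limitExponent a (k i))) * Real.exp (-s))) :=
      ((tendsto_finsetProd _ fun i _ => h.tendsto_momentWeight_mul (hk i) hs).const_mul _).mul
        (h.tendsto_laplaceMoment_zero_pow hs r)
    refine h1.congr' ?_
    filter_upwards [(tendsto_const_div_atTop_nhds_zero_nat s).eventually_le_const hT] with n hn
    simp only [hf, if_pos hn]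

theorem tendsto_laplace_integral (h : HasRegularTail μ a) (hr : 1 ≤ r) (hk : ∀ i, 1 ≤ k i)
    (hint : IntegrableOn (fun t => t⁻¹ * ∏ i, laplaceMoment μ (k i) t) (Set.Ioi 0)) :
    Tendsto (fun n : ℕ => (∏ i, momentWeight μ n (k i)) * ∫ t in Set.Ioi (0 : ℝ),
      (t⁻¹ * ∏ i, laplaceMoment μ (k i) t) * laplaceMoment μ 0 t ^ (n - r)) atTop
      (𝓝 ((∏ i, limitConst a (k i)) * Real.Gamma (∑ i, limitExponent a (k i)))) := by
  have := h.prob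
  obtain ⟨T, hT, hφ⟩ := h.laplaceMoment_zero_le
  have h1 := (h.tendsto_main_part hr hk hT hφ).add (h.tendsto_tail_part k hint hT (hφ T hT le_rfl))
  rw [add_zero] at h1
  refine h1.congr fun n => ?_
  have hi : IntegrableOn (fun t => (t⁻¹ * ∏ i, laplaceMoment μ (k i) t)
      * laplaceMoment μ 0 t ^ (n - r)) (Set.Ioi 0) := by
    refine hint.mul_bdd (c := 1)
      ((measurable_laplaceMoment μ 0).pow_const _).aestronglyMeasurable ?_
    filter_upwards [ae_restrict_mem measurableSet_Ioi] with t (ht : 0 < t)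
    have h0 := laplaceMoment_nonneg h.nonneg 0 ht.le
    rw [Real.norm_of_nonneg (by positivity)]
    refine pow_le_one₀ h0 ?_
    have h2 := integral_mono_of_nonneg (μ := μ) (g := fun _ => (1 : ℝ))
      (f := fun x => (t * x) ^ 0 * Real.exp (-(t * x)))
      (ae_of_all _ fun x => by simp only [Pi.zero_apply]; positivity)
      (integrable_const _) (by
        filter_upwards [h.nonneg] with x hx
        simp only [pow_zero, one_mul, Real.exp_le_one_iff, Left.neg_nonpos_iff]
        positivity)
    simpa [laplaceMoment] using h2
  rw [← mul_add, ← Set.Ioc_union_Ioi_eq_Ioi hT.le, setIntegral_union (Set.Ioc_disjoint_Ioi le_rfl)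
    measurableSet_Ioi (hi.mono_set Set.Ioc_subset_Ioi_self)
    (hi.mono_set (Set.Ioi_subset_Ioi hT.le))]

end Limit

end HasRegularTail

/-! ### Exponents and constants in terms of `N_1` -/

theorem numOnes_le {r : ℕ} (k : Fin r → ℕ) : numOnes k ≤ r := by
  simpa [numOnes] using Finset.card_filter_le Finset.univ fun i => k i = 1

theorem card_filter_ne_one {r : ℕ} (k : Fin r → ℕ) :
    (Finset.univ.filter fun i => ¬k i = 1).card = r - numOnes k := by
  have := Finset.card_filter_add_card_filter_not (s := (Finset.univ : Finset (Fin r)))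
    (fun i => k i = 1)
  rw [Finset.card_univ, Fintype.card_fin] at this
  unfold numOnes
  omega

theorem HasRegularTail.sum_limitExponent (a : ℝ) {r : ℕ} (k : Fin r → ℕ) :
    ∑ i, limitExponent a (k i) = (numOnes k : ℝ) * (1 - a) + r * a := by
  unfold limitExponent
  rw [Finset.sum_ite, Finset.sum_const, Finset.sum_const, card_filter_ne_one, nsmul_eq_mul,
    nsmul_eq_mul, Nat.cast_sub (numOnes_le k)]
  unfold numOnes
  ring

theorem HasRegularTail.prod_limitConst (a : ℝ) {r : ℕ} {k : Fin r → ℕ} (hk : ∀ i, 1 ≤ k i) :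
    ∏ i, limitConst a (k i) = a ^ (r - numOnes k) *
      ∏ i ∈ Finset.univ.filter (fun i => 2 ≤ k i), Real.Gamma ((k i : ℝ) - a) := by
  unfold limitConst
  rw [Finset.prod_ite, Finset.prod_const_one, one_mul, Finset.prod_mul_distrib, Finset.prod_const,
    card_filter_ne_one]
  congr 2
  ext i
  have := hk i
  simp only [Finset.mem_filter, Finset.mem_univ, true_and]
  omega

theorem HasRegularTail.prod_momentWeight {μ : Measure ℝ} {a : ℝ} {r n : ℕ} (hn : 0 < n)
    (k : Fin r → ℕ) {l : ℝ} (hG : μ.real (Set.Ioi (n : ℝ)) = (n : ℝ) ^ (-a) * l) :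
    ∏ i, momentWeight μ n (k i)
      = (n : ℝ) ^ ((numOnes k : ℝ) * (1 - a) + r * a) / l ^ (r - numOnes k) := by
  have hn0 : (0 : ℝ) < n := by exact_mod_cast hn
  unfold momentWeight
  rw [Finset.prod_ite, Finset.prod_const, Finset.prod_const, card_filter_ne_one, hG, mul_inv,
    ← Real.rpow_neg hn0.le, neg_neg, mul_pow, ← Real.rpow_mul_natCast hn0.le,
    ← Real.rpow_natCast (n : ℝ), ← mul_assoc, ← Real.rpow_add hn0, inv_pow, div_eq_mul_inv,
    Nat.cast_sub (numOnes_le k)]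
  congr 2
  unfold numOnes
  ring

/-! ### Application to the i.i.d. row -/

theorem selfNormalized_pow_two_mul {Ω : Type*} (X : ℕ → Ω → ℝ) (n j m : ℕ) (ω : Ω) :
    selfNormalized X n j ω ^ (2 * m) = (X j ω ^ 2 / ∑ l : Fin n, X l ω ^ 2) ^ m := by
  rw [selfNormalized, pow_mul, div_pow, Real.sq_sqrt (Finset.sum_nonneg fun l _ => sq_nonneg _),
    Finset.sum_range]

section Model

variable {Ω : Type*} [MeasurableSpace Ω] {P : Measure Ω} {X : ℕ → Ω → ℝ}

/-- The remaining `m` variables enter only through the denominator: they carry exponent `0`, hence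
one factor `M_0` each. Writing `n = r + m` avoids truncated subtraction. -/
theorem Gamma_mul_mixedMoment [IsProbabilityMeasure P]
    (hindep : iIndepFun X P) (hident : ∀ j, IdentDistrib (X j) (X 0) P P)
    {r : ℕ} {k : Fin r → ℕ} (hr : 1 ≤ r) (hk : ∀ i, 1 ≤ k i) (m : ℕ) :
    IntegrableOn (fun t => (t⁻¹ * ∏ i, laplaceMoment (P.map fun ω => X 0 ω ^ 2) (k i) t)
      * laplaceMoment (P.map fun ω => X 0 ω ^ 2) 0 t ^ m) (Set.Ioi 0) ∧
    ∫ t in Set.Ioi (0 : ℝ), (t⁻¹ * ∏ i, laplaceMoment (P.map fun ω => X 0 ω ^ 2) (k i) t)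
      * laplaceMoment (P.map fun ω => X 0 ω ^ 2) 0 t ^ m
      = Real.Gamma (∑ i, k i : ℕ) * mixedMoment P X (r + m) k := by
  have hsq : Measurable fun x : ℝ => x ^ 2 := by fun_prop
  have hid : ∀ j, IdentDistrib (fun ω => X j ω ^ 2) (fun ω => X 0 ω ^ 2) P P :=
    fun j => (hident j).comp hsq
  have hindep' : iIndepFun (fun (l : Fin (r + m)) ω => X l ω ^ 2) P :=
    (hindep.comp (fun _ x => x ^ 2) fun _ => hsq).precomp Fin.val_injective
  set κ : Fin (r + m) → ℕ := Fin.append k fun _ => 0 with hκdef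
  have hsum : ∑ l, κ l = ∑ i, k i := by simp [hκdef, Fin.sum_univ_add]
  have hκ : 1 ≤ ∑ l, κ l := by
    rw [hsum]
    exact (hk ⟨0, hr⟩).trans (Finset.single_le_sum (fun _ _ => Nat.zero_le _) (Finset.mem_univ _))
  obtain ⟨h1, h2⟩ := Gamma_mul_integral_prod_div_sum (μ := P.map fun ω => X 0 ω ^ 2)
    (Z := fun (l : Fin (r + m)) ω => X l ω ^ 2)
    (fun l => (hid l).aemeasurable_fst) (fun _ _ => sq_nonneg _) (fun l => (hid l).map_eq)
    hindep' hκ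
  have e1 : ∀ t, t⁻¹ * ∏ l, laplaceMoment (P.map fun ω => X 0 ω ^ 2) (κ l) t
      = (t⁻¹ * ∏ i, laplaceMoment (P.map fun ω => X 0 ω ^ 2) (k i) t)
        * laplaceMoment (P.map fun ω => X 0 ω ^ 2) 0 t ^ m := fun t => by
    simp [hκdef, Fin.prod_univ_add, mul_assoc]
  simp only [e1] at h1 h2
  refine ⟨h1, h2.trans ?_⟩
  rw [hsum, mixedMoment]
  congr 2
  ext ω
  simp only [selfNormalized_pow_two_mul]
  rw [Fin.prod_univ_add]
  simp [hκdef]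

theorem tail_sq_eq (hm : AEMeasurable (X 0) P) {α : ℝ} {L : ℝ → ℝ}
    (htail : ∀ x : ℝ, 0 < x → P.real {ω | x < |X 0 ω|} = x ^ (-α) * L x) {y : ℝ} (hy : 0 < y) :
    (P.map fun ω => X 0 ω ^ 2).real (Set.Ioi y) = y ^ (-(α / 2)) * L (Real.sqrt y) := by
  rw [map_measureReal_apply_of_aemeasurable (hm.pow_const 2) measurableSet_Ioi]
  have e : (fun ω => X 0 ω ^ 2) ⁻¹' Set.Ioi y = {ω | Real.sqrt y < |X 0 ω|} := by
    ext ω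
    simp only [Set.mem_preimage, Set.mem_Ioi, Set.mem_ofPred_eq]
    rw [← Real.sqrt_sq_eq_abs, Real.sqrt_lt_sqrt_iff hy.le]
  rw [e, htail _ (Real.sqrt_pos.2 hy), Real.sqrt_eq_rpow, ← Real.rpow_mul hy.le]
  congr 2
  ring

theorem hasRegularTail_map_sq [IsProbabilityMeasure P]
    (hm : AEMeasurable (X 0) P) {α : ℝ} (hα2 : 2 < α) (hα4 : α < 4)
    (hvar : ∫ ω, X 0 ω ^ 2 ∂P = 1) {L : ℝ → ℝ} (hL : IsSlowlyVarying L)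
    (htail : ∀ x : ℝ, 0 < x → P.real {ω | x < |X 0 ω|} = x ^ (-α) * L x) :
    HasRegularTail (P.map fun ω => X 0 ω ^ 2) (α / 2) where
  prob := Measure.isProbabilityMeasure_map (hm.pow_const 2)
  nonneg := by
    rw [ae_map_iff (hm.pow_const 2) measurableSet_Ici]
    exact ae_of_all _ fun ω => sq_nonneg _
  mean := by
    rw [integral_map (hm.pow_const 2) (by fun_prop)]
    exact hvar
  one_lt := by linarith
  lt_two := by linarith
  pos := by
    intro y
    have := Measure.isProbabilityMeasure_map (μ := P) (hm.pow_const 2)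
    -- `L` is known to be positive only far out; monotonicity of the tail carries positivity back to
    -- every `y`.
    obtain ⟨A, -, hA⟩ := hL.measurable_pos
    obtain ⟨z, hz0, hzy, hzA⟩ := ((eventually_gt_atTop (0 : ℝ)).and ((eventually_ge_atTop y).and
      (Real.tendsto_sqrt_atTop.eventually_gt_atTop A))).exists
    have h1 : 0 < (P.map fun ω => X 0 ω ^ 2).real (Set.Ioi z) := by
      rw [tail_sq_eq hm htail hz0]
      exact mul_pos (Real.rpow_pos_of_pos hz0 _) (hA _ hzA)
    exact h1.trans_le (measureReal_mono (Set.Ioi_subset_Ioi hzy))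
  tendsto := by
    intro c hc
    have h1 := ((hL.tendsto_ratio (Real.sqrt c) (Real.sqrt_pos.2 hc)).comp
      Real.tendsto_sqrt_atTop).const_mul (c ^ (-(α / 2)))
    rw [mul_one] at h1
    refine h1.congr' ?_
    filter_upwards [eventually_gt_atTop (0 : ℝ)] with y hy
    rw [tail_sq_eq hm htail hy, tail_sq_eq hm htail (mul_pos hc hy), Real.sqrt_mul hc.le,
      Real.mul_rpow hc.le hy.le]
    simp only [Function.comp]
    have := (Real.rpow_pos_of_pos hy (-(α / 2))).ne'
    field_simp

theorem tendsto_mixedMoment [IsProbabilityMeasure P]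
    (hindep : iIndepFun X P)
    (hident : ∀ j, IdentDistrib (X j) (X 0) P P) {α : ℝ} (hα2 : 2 < α) (hα4 : α < 4)
    (hvar : ∫ ω, X 0 ω ^ 2 ∂P = 1) {L : ℝ → ℝ} (hL : IsSlowlyVarying L)
    (htail : ∀ x : ℝ, 0 < x → P.real {ω | x < |X 0 ω|} = x ^ (-α) * L x)
    {r : ℕ} {k : Fin r → ℕ} (hr : 1 ≤ r) (hk : ∀ i, 1 ≤ k i) :
    Tendsto
      (fun n : ℕ => (n : ℝ) ^ ((numOnes k : ℝ) * (1 - α / 2) + (r : ℝ) * (α / 2))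
          / L (Real.sqrt n) ^ (r - numOnes k) * mixedMoment P X n k)
      atTop
      (𝓝 ((α / 2) ^ (r - numOnes k)
          * Real.Gamma ((numOnes k : ℝ) * (1 - α / 2) + (r : ℝ) * (α / 2))
          * (∏ i ∈ Finset.univ.filter (fun i => 2 ≤ k i), Real.Gamma ((k i : ℝ) - α / 2))
          / Real.Gamma ((∑ i, k i : ℕ) : ℝ))) := by
  have hm : AEMeasurable (X 0) P := (hident 0).aemeasurable_fst
  have h := hasRegularTail_map_sq hm hα2 hα4 hvar hL htail
  -- Sample size `n = r` gives integrability without any help from powers of `M_0`.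
  have hint := (Gamma_mul_mixedMoment hindep hident hr hk 0).1
  simp only [pow_zero, mul_one] at hint
  have hK : (0 : ℝ) < (∑ i, k i : ℕ) := by
    have := (hk ⟨0, hr⟩).trans
      (Finset.single_le_sum (fun _ _ => Nat.zero_le _) (Finset.mem_univ _))
    exact_mod_cast this
  have hΓ := Real.Gamma_pos_of_pos hK
  have h1 := (h.tendsto_laplace_integral hr hk hint).div_const (Real.Gamma (∑ i, k i : ℕ))
  rw [HasRegularTail.prod_limitConst _ hk, HasRegularTail.sum_limitExponent,
    mul_right_comm ((α / 2) ^ _)] at h1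
  refine h1.congr' ?_
  filter_upwards [eventually_ge_atTop r] with n hn
  obtain ⟨m, rfl⟩ := Nat.exists_eq_add_of_le hn
  have hn0 : (0 : ℝ) < (r + m : ℕ) := by exact_mod_cast (by omega : 0 < r + m)
  rw [HasRegularTail.prod_momentWeight (by omega) k (tail_sq_eq hm htail hn0),
    Nat.add_sub_cancel_left, (Gamma_mul_mixedMoment hindep hident hr hk m).2]
  field_simp

end Model

theorem lemma4p1 {Ω : Type*} [MeasurableSpace Ω] (P : Measure Ω) [IsProbabilityMeasure P]
    (X : ℕ → Ω → ℝ) (hindep : iIndepFun X P) (hident : ∀ j, IdentDistrib (X j) (X 0) P P)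
    (α : ℝ) (hα2 : 2 < α) (hα4 : α < 4)
    (hvar : ∫ ω, X 0 ω ^ 2 ∂P = 1)
    (L : ℝ → ℝ) (hL : IsSlowlyVarying L)
    (htail : ∀ x : ℝ, 0 < x → P.real {ω | x < |X 0 ω|} = x ^ (-α) * L x) :
    (∀ (r : ℕ) (k : Fin r → ℕ), 1 ≤ r → (∀ i, 1 ≤ k i) →
      Tendsto
        (fun n : ℕ =>
          (n : ℝ) ^ ((numOnes k : ℝ) * (1 - α / 2) + (r : ℝ) * (α / 2))
            / L (Real.sqrt n) ^ (r - numOnes k) * mixedMoment P X n k)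
        atTop
        (𝓝 ((α / 2) ^ (r - numOnes k)
            * Real.Gamma ((numOnes k : ℝ) * (1 - α / 2) + (r : ℝ) * (α / 2))
            * (∏ i ∈ Finset.univ.filter (fun i => 2 ≤ k i), Real.Gamma ((k i : ℝ) - α / 2))
            / Real.Gamma ((∑ i, k i : ℕ) : ℝ)))) ∧
    (∀ k : ℕ, 2 ≤ k →
      Tendsto
        (fun n : ℕ => (n : ℝ) ^ (α / 2) / L (Real.sqrt n) * mixedMoment P X n ![k])
        atTop
        (𝓝 (α * Real.Gamma (α / 2) * Real.Gamma ((k : ℝ) - α / 2) / (2 * Real.Gamma (k : ℝ))))) := by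
  refine ⟨fun r k hr hk => tendsto_mixedMoment hindep hident hα2 hα4 hvar hL htail hr hk,
    fun k hk => ?_⟩
  have h := tendsto_mixedMoment hindep hident hα2 hα4 hvar hL htail (k := ![k]) le_rfl
    (fun i => by fin_cases i; exact (by omega : 1 ≤ k))
  have h1 : numOnes ![k] = 0 := by
    simp [numOnes, show k ≠ 1 by omega]
  have h2 : (Finset.univ.filter fun i => 2 ≤ (![k] : Fin 1 → ℕ) i) = Finset.univ := by
    simp [hk]
  rw [h1, h2] at h
  simp only [Nat.cast_zero, zero_mul, zero_add, Nat.cast_one, one_mul, Nat.sub_zero, pow_one,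
    Finset.univ_unique, Finset.prod_singleton, Finset.sum_singleton, Fin.default_eq_zero,
    Matrix.cons_val_zero] at h
  convert h using 2
  ring
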